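/- Consider a $Q$-hop-relay ($Q\ge 1$ relay clusters) MIMO amplify-and-forward network with $L$ links. Let $\mathbf H_0^l$ be the channel from the source of link $l$ to cluster $1$, $\mathbf H_q$ ($1\le q\le Q-1$) the channel from cluster $q$ to cluster $q+1$, $\mathbf H_Q^l$ the channel from cluster $Q$ to the destination of link $l$ (which has at least one antenna). Let $\mathbf W_q$ and $\mathbf W_{Q+1}^l$ be the noise covariances at cluster $q$ and at the destination of link $l$, let $\hat{\mathbf W}_0^l$ and $\hat{\mathbf W}_q$ be the linear constraint matrices at the source of link $l$ and at cluster $q$ (all of these are positive semidefinite), and let $\Phi=(\phi_{l,k})\in\{0,1\}^{L\times L}$, $\phi_{l,l}=0$, be the coupling matrix. For relay precoders $\mathbf F=(\mathbf F_1,\dots,\mathbf F_Q)$ and positive semidefinite input covariances $\mathbf\Sigma=(\mathbf\Sigma_1,\dots,\mathbf\Sigma_L)$ put, for $q\le q'$, $$\mathbf B_{q,q'}=\mathbf F_{q'}\mathbf H_{q'-1}\mathbf F_{q'-1}\cdots\mathbf H_q\mathbf F_q,\qquad \check{\mathbf H}_{l,k}=\mathbf H_Q^l\mathbf B_{1,Q}\mathbf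 H_0^k,$$ $$\mathbf W_l'=\sum_{q=1}^Q\mathbf H_Q^l\mathbf B_{q,Q}\mathbf W_q\mathbf B_{q,Q}^\dagger\mathbf H_Q^{l\dagger}+\mathbf W_{Q+1}^l,\qquad \mathbf\Omega_l=\mathbf W_l'+\sum_k\phi_{l,k}\check{\mathbf H}_{l,k}\mathbf\Sigma_k\check{\mathbf H}_{l,k}^\dagger,$$ $$\mathcal I_l=\log\left|\mathbf I+\check{\mathbf H}_{l,l}\mathbf\Sigma_l\check{\mathbf H}_{l,l}^\dagger\mathbf\Omega_l^{-1}\right|,\qquad \mathbf\Sigma_q^R=\sum_l\mathbf B_{1,q}\mathbf H_0^l\mathbf\Sigma_l\mathbf H_0^{l\dagger}\mathbf B_{1,q}^\dagger+\sum_{q'=1}^q\mathbf B_{q',q}\mathbf W_{q'}\mathbf B_{q',q}^\dagger,$$ $$P_0^{\rm tx}=\sum_l\mathrm{Tr}(\mathbf\Sigma_l\hat{\mathbf W}_0^l),\qquad P_q^{\rm tx}=\mathrm{Tr}(\mathbf\Sigma_q^R\hat{\mathbf W}_q)\quad(1\le q\le Q).$$ Let $\mathbf d=(d_1,\dots,d_{Q+1})$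 with $d_q>0$ for $1\le q\le Q$ and $d_{Q+1}=1$, and put $$\hat{\mathbf W}_l'(\mathbf d)=\sum_{q=1}^Q\mathbf H_0^{l\dagger}\mathbf B_{1,q}^\dagger\, d_{q+1}\hat{\mathbf W}_q\,\mathbf B_{1,q}\mathbf H_0^l+d_1\hat{\mathbf W}_0^l .$$ Assume that $\mathbf W_l'$ and $\hat{\mathbf W}_l'(1,\dots,1)$ are nonsingular for every $l$ (for instance, that $\mathbf W_{Q+1}^l$ and $\hat{\mathbf W}_0^l$ are). *Covariance transformation* of $\mathbf\Sigma$ with parameters $\{[\check{\mathbf H}_{l,k}],[\mathbf W_l'],[\hat{\mathbf W}_l'(\mathbf d)]\}$. (1) Write $\mathbf\Sigma_l=\sum_{m=1}^{M_l}p_{l,m}\mathbf t_{l,m}\mathbf t_{l,m}^\dagger$ with $p_{l,m}>0$, $\|\mathbf t_{l,m}\|=1$. (2) Let $\mathbf r_{l,m}$ be a unit vector which is a scalar multiple of $\big(\sum_{i>m}p_{l,i}\check{\mathbf H}_{l,l}\mathbf t_{l,i}\mathbf t_{l,i}^\dagger\check{\mathbf H}_{l,l}^\dagger+\mathbf\Omega_l\big)^{-1}\check{\mathbf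 H}_{l,l}\mathbf t_{l,m}$; if $\check{\mathbf H}_{l,l}\mathbf t_{l,m}=0$, let $\mathbf r_{l,m}$ be any unit vector. (3) Let $\mathbf\Psi$ have entries $\mathbf\Psi_{l,m}^{k,n}=\phi_{l,k}|\mathbf r_{l,m}^\dagger\check{\mathbf H}_{l,k}\mathbf t_{k,n}|^2$ for $k\ne l$, $|\mathbf r_{l,m}^\dagger\check{\mathbf H}_{l,l}\mathbf t_{l,n}|^2$ for $k=l$, $m<n$, and $0$ for $k=l$, $m\ge n$. Let $\iota_{l,m}=\sum_{k,n}\mathbf\Psi_{l,m}^{k,n}p_{k,n}+\mathbf r_{l,m}^\dagger\mathbf W_l'\mathbf r_{l,m}$ be the interference-plus-noise power and $\gamma_{l,m}=p_{l,m}|\mathbf r_{l,m}^\dagger\check{\mathbf H}_{l,l}\mathbf t_{l,m}|^2/\iota_{l,m}$ the SINR of stream $(l,m)$. Let $\mathbf D$ be the diagonal matrix with entries $\gamma_{l,m}/|\mathbf r_{l,m}^\dagger\check{\mathbf H}_{l,l}\mathbf t_{l,m}|^2$ (read as $p_{l,m}/\iota_{l,m}$ if the denominator vanishes), let $\hat n_{l,m}=\mathbf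 t_{l,m}^\dagger\hat{\mathbf W}_l'(\mathbf d)\mathbf t_{l,m}$, and put $\mathbf q=(\mathbf D^{-1}-\mathbf\Psi^T)^{-1}\hat{\mathbf n}$. (4) $\hat{\mathbf\Sigma}_l(\mathbf d)=\sum_m q_{l,m}\mathbf r_{l,m}\mathbf r_{l,m}^\dagger$. *Scaled dual network.* All directions are reversed, channels are replaced by their conjugate transposes and $\Phi$ by $\Phi^T$; the noise covariance is $d_{q+1}\hat{\mathbf W}_q$ at cluster $q$ and $d_1\hat{\mathbf W}_0^l$ at the destination of dual link $l$; the relay precoders are $\hat{\mathbf F}=(\mathbf F_1^\dagger,\dots,\mathbf F_Q^\dagger)$. With inputs $\hat{\mathbf\Sigma}(\mathbf d)$ its rates are $\hat{\mathcal I}_l=\log|\mathbf I+\check{\mathbf H}_{l,l}^\dagger\hat{\mathbf\Sigma}_l(\mathbf d)\check{\mathbf H}_{l,l}\hat{\mathbf\Omega}_l^{-1}|$, where $\hat{\mathbf\Omega}_l=\hat{\mathbf W}_l'(\mathbf d)+\sum_k\phi_{k,l}\check{\mathbf H}_{k,l}^\dagger\hat{\mathbf\Sigma}_k(\mathbf d)\check{\mathbf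 H}_{k,l}$, and the covariance of the transmit signal at cluster $q$ is $$\hat{\mathbf\Sigma}_q^R(\mathbf d)=\sum_l\mathbf B_{q,Q}^\dagger\mathbf H_Q^{l\dagger}\hat{\mathbf\Sigma}_l(\mathbf d)\mathbf H_Q^l\mathbf B_{q,Q}+\sum_{q'=q}^Q d_{q'+1}\mathbf B_{q,q'}^\dagger\hat{\mathbf W}_{q'}\mathbf B_{q,q'}.$$ **Claim.** Such a covariance transformation of $\mathbf\Sigma$ exists. For all choices made in steps (1) and (2), it is well defined ($\mathbf D$ has positive diagonal entries, $\mathbf D^{-1}-\mathbf\Psi^T$ is nonsingular), the powers $q_{l,m}$ are nonnegative, every $\hat{\mathbf\Sigma}_l(\mathbf d)$ is positive semidefinite, and $$\hat{\mathcal I}_l\ge\mathcal I_l\quad\text{for all }l,\qquad \sum_{l=1}^L\mathrm{Tr}\big(\hat{\mathbf\Sigma}_l(\mathbf d)\mathbf W_{Q+1}^l\big)+\sum_{q=1}^Q\mathrm{Tr}\big(\hat{\mathbf\Sigma}_q^R(\mathbf d)\mathbf W_q\big)=\sum_{q=0}^Q d_{q+1}P_q^{\rm tx}.$$ -/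

import Mathlib

open scoped Matrix ComplexOrder

noncomputable section

/-! ### One-hop B-MAC interference networks and the covariance transformation -/

/-- The parameters of a one-hop B-MAC interference network with `L` links: `H l k` is the channel
from the transmitter of link `k` to the receiver of link `l`, `W l` is the noise covariance at the
receiver of link `l`, `What l` is the linear constraint matrix of link `l`, and `Φ` is the coupling
matrix (`Φ l k` tells whether signal `k` interferes with signal `l`). -/
structure IFNet (L : ℕ) (nT nR : Fin L → ℕ) where
  H : ∀ l k, Matrix (Fin (nR l)) (Fin (nT k)) ℂ
  W : ∀ l, Matrix (Fin (nR l)) (Fin (nR l)) ℂ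
  What : ∀ l, Matrix (Fin (nT l)) (Fin (nT l)) ℂ
  Φ : Matrix (Fin L) (Fin L) ℝ

/-- Stream data: link `l` carries `M l` streams; stream `(l, m)` has transmit power `p l m`,
transmit vector `t l m` and receive vector `r l m`. -/
structure Streams (L : ℕ) (nT nR : Fin L → ℕ) where
  M : Fin L → ℕ
  p : ∀ l, Fin (M l) → ℝ
  t : ∀ l, Fin (M l) → Fin (nT l) → ℂ
  r : ∀ l, Fin (M l) → Fin (nR l) → ℂ

namespace IFNet

variable {L : ℕ} {nT nR : Fin L → ℕ}

/-- The interference-plus-noise covariance `Ω_l` at the receiver of link `l`. -/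
def Ω (G : IFNet L nT nR) (S : ∀ l, Matrix (Fin (nT l)) (Fin (nT l)) ℂ) (l : Fin L) :
    Matrix (Fin (nR l)) (Fin (nR l)) ℂ :=
  G.W l + ∑ k, (G.Φ l k : ℂ) • (G.H l k * S k * (G.H l k)ᴴ)

end IFNet

namespace Streams

variable {L : ℕ} {nT nR : Fin L → ℕ}

/-- The index type of all streams of all links. -/
abbrev Idx (s : Streams L nT nR) : Type := Σ l : Fin L, Fin (s.M l)

/-- The covariance that the streams `i > m` of link `l`, together with the
interference-plus-noise, produce at the receiver of link `l`. -/
def sicCov (s : Streams L nT nR) (G : IFNet L nT nR)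
    (S : ∀ l, Matrix (Fin (nT l)) (Fin (nT l)) ℂ) (l : Fin L) (m : Fin (s.M l)) :
    Matrix (Fin (nR l)) (Fin (nR l)) ℂ :=
  ∑ i ∈ Finset.Ioi m, (s.p l i : ℂ) •
      (G.H l l * Matrix.vecMulVec (s.t l i) (star (s.t l i)) * (G.H l l)ᴴ) + G.Ω S l

/-- `s` is a choice made in the first two steps of the covariance transformation of the input
covariances `S` for the network `G`: a decomposition of each `S l` into streams of positive power
and unit transmit vectors, together with unit MMSE-SIC receive vectors. When `H_{l,l} t_{l,m} = 0`
the MMSE-SIC vector is zero and cannot be normalized; then every unit vector is admitted. -/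
structure IsFor (s : Streams L nT nR) (G : IFNet L nT nR)
    (S : ∀ l, Matrix (Fin (nT l)) (Fin (nT l)) ℂ) : Prop where
  power_pos : ∀ l m, 0 < s.p l m
  t_unit : ∀ l m, ∑ i, ‖s.t l m i‖ ^ 2 = 1
  decomp : ∀ l, S l = ∑ m, (s.p l m : ℂ) • Matrix.vecMulVec (s.t l m) (star (s.t l m))
  r_unit : ∀ l m, ∑ i, ‖s.r l m i‖ ^ 2 = 1
  mmse : ∀ l m, G.H l l *ᵥ s.t l m ≠ 0 →
    ∃ α : ℂ, s.r l m = α • ((s.sicCov G S l m)⁻¹ *ᵥ (G.H l l *ᵥ s.t l m))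

/-- The power gain `|r_{a}† H t_{b}|²` from stream `b` to stream `a`. -/
def gain (s : Streams L nT nR) (G : IFNet L nT nR) (a b : s.Idx) : ℝ :=
  ‖star (s.r a.1 a.2) ⬝ᵥ (G.H a.1 b.1 *ᵥ s.t b.1 b.2)‖ ^ 2

/-- The cross-talk matrix `Ψ`: row `(l, m)`, column `(k, n)`. -/
def Ψ (s : Streams L nT nR) (G : IFNet L nT nR) : Matrix s.Idx s.Idx ℝ := fun a b =>
  if h : b.1 = a.1 then
    (if a.2 < Fin.cast (congrArg s.M h) b.2 then s.gain G a b else 0)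
  else G.Φ a.1 b.1 * s.gain G a b

/-- The power of interference plus noise in the output of the receive vector of stream `a`. -/
def inr (s : Streams L nT nR) (G : IFNet L nT nR) (a : s.Idx) : ℝ :=
  ∑ b, s.Ψ G a b * s.p b.1 b.2 + (star (s.r a.1 a.2) ⬝ᵥ (G.W a.1 *ᵥ s.r a.1 a.2)).re

/-- The SINR `γ_{l,m}` of a stream. -/
def sinr (s : Streams L nT nR) (G : IFNet L nT nR) (a : s.Idx) : ℝ :=
  s.p a.1 a.2 * s.gain G a a / s.inr G a

/-- The diagonal entry `γ_{l,m} / |r_{l,m}† H_{l,l} t_{l,m}|²` of `D`. If the gain in the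
denominator vanishes (so that `γ_{l,m} = 0`), it is the value `p_{l,m} / (interference + noise)`,
with which the quotient agrees in all other cases (`dEntry_eq`). -/
def dEntry (s : Streams L nT nR) (G : IFNet L nT nR) (a : s.Idx) : ℝ :=
  if s.gain G a a = 0 then s.p a.1 a.2 / s.inr G a else s.sinr G a / s.gain G a a

theorem dEntry_eq (s : Streams L nT nR) (G : IFNet L nT nR) (a : s.Idx) :
    s.dEntry G a = s.p a.1 a.2 / s.inr G a := by
  unfold dEntry sinr
  split_ifs with h
  · rfl
  · field_simp

/-- The diagonal matrix `D`. -/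
def D (s : Streams L nT nR) (G : IFNet L nT nR) : Matrix s.Idx s.Idx ℝ :=
  Matrix.diagonal (s.dEntry G)

/-- The vector `n̂` with entries `t_{l,m}† Ŵ_l t_{l,m}`. -/
def nhat (s : Streams L nT nR) (G : IFNet L nT nR) : s.Idx → ℝ := fun a =>
  (star (s.t a.1 a.2) ⬝ᵥ (G.What a.1 *ᵥ s.t a.1 a.2)).re

/-- The reverse transmit powers `q = (D⁻¹ - Ψᵀ)⁻¹ n̂`. -/
def q (s : Streams L nT nR) (G : IFNet L nT nR) : s.Idx → ℝ :=
  ((s.D G)⁻¹ - (s.Ψ G)ᵀ)⁻¹ *ᵥ s.nhat G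

/-- The result `Σ̂_l = ∑ₘ q_{l,m} r_{l,m} r_{l,m}†` of the covariance transformation. -/
def covTransform (s : Streams L nT nR) (G : IFNet L nT nR) (l : Fin L) :
    Matrix (Fin (nR l)) (Fin (nR l)) ℂ :=
  ∑ m, (s.q G ⟨l, m⟩ : ℂ) • Matrix.vecMulVec (s.r l m) (star (s.r l m))

end Streams

/-! ### Multi-hop B-MAC amplify-and-forward relay networks and their duals -/

/-- The data of a B-MAC AF relay network with `L` links and `Q` relay clusters, numbered
`1, …, Q`. `nT l`, `nR l` are the antenna numbers of the source and the destination of link `l`,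
and `N q` is that of cluster `q`. Only `N q`, `W q`, `What q` with `1 ≤ q ≤ Q` and `H q` with
`1 ≤ q ≤ Q - 1` matter.
* `H0 l`: channel from the source of link `l` to cluster `1`; `H q`: from cluster `q` to cluster
  `q + 1`; `HQ l`: from cluster `Q` to the destination of link `l`;
* `W q`, `WD l`: noise covariances at cluster `q` and at the destination of link `l`;
* `WhatS l`, `What q`: linear constraint matrices at the source of link `l` and at cluster `q`;
* `Φ`: coupling matrix. -/
structure RelayNet (L Q : ℕ) (nT nR : Fin L → ℕ) (N : ℕ → ℕ) where
  H0 : ∀ l, Matrix (Fin (N 1)) (Fin (nT l)) ℂ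
  H : ∀ q, Matrix (Fin (N (q + 1))) (Fin (N q)) ℂ
  HQ : ∀ l, Matrix (Fin (nR l)) (Fin (N Q)) ℂ
  W : ∀ q, Matrix (Fin (N q)) (Fin (N q)) ℂ
  WD : ∀ l, Matrix (Fin (nR l)) (Fin (nR l)) ℂ
  WhatS : ∀ l, Matrix (Fin (nT l)) (Fin (nT l)) ℂ
  What : ∀ q, Matrix (Fin (N q)) (Fin (N q)) ℂ
  Φ : Matrix (Fin L) (Fin L) ℝ

namespace RelayNet

variable {L Q : ℕ} {nT nR : Fin L → ℕ} {N : ℕ → ℕ}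

/-- The standing conventions: noise covariances and constraint matrices are positive semidefinite,
and the coupling matrix is binary with zero diagonal. -/
structure Standing (net : RelayNet L Q nT nR N) : Prop where
  W_psd : ∀ q ∈ Finset.Icc 1 Q, (net.W q).PosSemidef
  WD_psd : ∀ l, (net.WD l).PosSemidef
  WhatS_psd : ∀ l, (net.WhatS l).PosSemidef
  What_psd : ∀ q ∈ Finset.Icc 1 Q, (net.What q).PosSemidef
  Φ_binary : ∀ l k, net.Φ l k = 0 ∨ net.Φ l k = 1
  Φ_diag : ∀ l, net.Φ l l = 0

/-- `B_{q,q'} = F_{q'} H_{q'-1} F_{q'-1} ⋯ H_q F_q` for `q ≤ q'` (and `0` for `q' < q`, a case that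
is not used). -/
def B (net : RelayNet L Q nT nR N) (F : ∀ q, Matrix (Fin (N q)) (Fin (N q)) ℂ) (q q' : ℕ) :
    Matrix (Fin (N q')) (Fin (N q)) ℂ :=
  if h : q ≤ q' then
    Nat.leRec (motive := fun m _ => Matrix (Fin (N m)) (Fin (N q)) ℂ) (F q)
      (fun m _ X => F (m + 1) * net.H m * X) h
  else 0

theorem B_self (net : RelayNet L Q nT nR N) (F : ∀ q, Matrix (Fin (N q)) (Fin (N q)) ℂ) (q : ℕ) :
    net.B F q q = F q := by
  simp [B]

theorem B_succ (net : RelayNet L Q nT nR N) (F : ∀ q, Matrix (Fin (N q)) (Fin (N q)) ℂ)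
    {q q' : ℕ} (h : q ≤ q') :
    net.B F q (q' + 1) = F (q' + 1) * net.H q' * net.B F q q' := by
  have h' : q ≤ q' + 1 := Nat.le_succ_of_le h
  simp only [B, dif_pos h, dif_pos h']
  rw [Nat.leRec_succ]

/-- The equivalent channel `Ȟ_{l,k} = H_Q^l B_{1,Q} H_0^k`. -/
def Hcheck (net : RelayNet L Q nT nR N) (F : ∀ q, Matrix (Fin (N q)) (Fin (N q)) ℂ)
    (l k : Fin L) : Matrix (Fin (nR l)) (Fin (nT k)) ℂ :=
  net.HQ l * net.B F 1 Q * net.H0 k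

/-- The covariance `Σ_q^R` of the transmit signal at relay cluster `q`. -/
def relayCov (net : RelayNet L Q nT nR N) (S : ∀ l, Matrix (Fin (nT l)) (Fin (nT l)) ℂ)
    (F : ∀ q, Matrix (Fin (N q)) (Fin (N q)) ℂ) (q : ℕ) : Matrix (Fin (N q)) (Fin (N q)) ℂ :=
  ∑ l, net.B F 1 q * net.H0 l * S l * (net.H0 l)ᴴ * (net.B F 1 q)ᴴ
    + ∑ q' ∈ Finset.Icc 1 q, net.B F q' q * net.W q' * (net.B F q' q)ᴴ

/-- The total noise covariance `W'_l` at the destination of link `l`. -/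
def W' (net : RelayNet L Q nT nR N) (F : ∀ q, Matrix (Fin (N q)) (Fin (N q)) ℂ) (l : Fin L) :
    Matrix (Fin (nR l)) (Fin (nR l)) ℂ :=
  ∑ q ∈ Finset.Icc 1 Q, net.HQ l * net.B F q Q * net.W q * (net.B F q Q)ᴴ * (net.HQ l)ᴴ
    + net.WD l

/-- The interference-plus-noise covariance `Ω_l` at the destination of link `l`. -/
def Ω (net : RelayNet L Q nT nR N) (S : ∀ l, Matrix (Fin (nT l)) (Fin (nT l)) ℂ)
    (F : ∀ q, Matrix (Fin (N q)) (Fin (N q)) ℂ) (l : Fin L) :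
    Matrix (Fin (nR l)) (Fin (nR l)) ℂ :=
  net.W' F l + ∑ k, (net.Φ l k : ℂ) • (net.Hcheck F l k * S k * (net.Hcheck F l k)ᴴ)

/-- The rate `log |I + Ȟ_{l,l} Σ_l Ȟ_{l,l}† Ω_l⁻¹|` of link `l`. -/
def rate (net : RelayNet L Q nT nR N) (S : ∀ l, Matrix (Fin (nT l)) (Fin (nT l)) ℂ)
    (F : ∀ q, Matrix (Fin (N q)) (Fin (N q)) ℂ) (l : Fin L) : ℝ :=
  Real.log (1 + net.Hcheck F l l * S l * (net.Hcheck F l l)ᴴ * (net.Ω S F l)⁻¹).det.re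

/-- The linear costs `P_0^tx = ∑_l Tr(Σ_l Ŵ_0^l)` and `P_q^tx = Tr(Σ_q^R Ŵ_q)` for `q ≥ 1`. -/
def Ptx (net : RelayNet L Q nT nR N) (S : ∀ l, Matrix (Fin (nT l)) (Fin (nT l)) ℂ)
    (F : ∀ q, Matrix (Fin (N q)) (Fin (N q)) ℂ) (q : ℕ) : ℝ :=
  if q = 0 then ∑ l, (S l * net.WhatS l).trace.re else (net.relayCov S F q * net.What q).trace.re

/-- The constraint matrix `Ŵ'_l = ∑_q H_0^l† B_{1,q}† Ŵ_q B_{1,q} H_0^l + Ŵ_0^l` of the equivalent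
one-hop network. -/
def What' (net : RelayNet L Q nT nR N) (F : ∀ q, Matrix (Fin (N q)) (Fin (N q)) ℂ) (l : Fin L) :
    Matrix (Fin (nT l)) (Fin (nT l)) ℂ :=
  ∑ q ∈ Finset.Icc 1 Q, (net.H0 l)ᴴ * (net.B F 1 q)ᴴ * net.What q * net.B F 1 q * net.H0 l
    + net.WhatS l

/-- The constraint matrix
`Ŵ'_l(d) = ∑_q H_0^l† B_{1,q}† d_{q+1} Ŵ_q B_{1,q} H_0^l + d_1 Ŵ_0^l`. -/
def scaledWhat' (net : RelayNet L Q nT nR N) (d : ℕ → ℝ)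
    (F : ∀ q, Matrix (Fin (N q)) (Fin (N q)) ℂ) (l : Fin L) :
    Matrix (Fin (nT l)) (Fin (nT l)) ℂ :=
  ∑ q ∈ Finset.Icc 1 Q,
      (net.H0 l)ᴴ * (net.B F 1 q)ᴴ * ((d (q + 1) : ℂ) • net.What q) * net.B F 1 q * net.H0 l
    + (d 1 : ℂ) • net.WhatS l

/-- The one-hop network with parameters `{[Ȟ_{l,k}], [W'_l], [Ŵ'_l(d)]}` and coupling matrix `Φ`. -/
def scaledIFNet (net : RelayNet L Q nT nR N) (d : ℕ → ℝ)
    (F : ∀ q, Matrix (Fin (N q)) (Fin (N q)) ℂ) : IFNet L nT nR where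
  H := net.Hcheck F
  W := net.W' F
  What := net.scaledWhat' d F
  Φ := net.Φ

/-! #### The dual network

All transmission directions are reversed, channels are replaced by their conjugate transposes, the
coupling matrix by its transpose, and the noise covariances are `Ŵ_q` at relay cluster `q` and
`Ŵ_0^l` at the destination of dual link `l`. The matrices `Fhat q` are the dual relay precoders. -/

/-- `B̂_{q,q'} = F̂_{q'}† H_{q'-1} F̂_{q'-1}† ⋯ H_q F̂_q†` for `q ≤ q'`. -/
def Bhat (net : RelayNet L Q nT nR N) (Fhat : ∀ q, Matrix (Fin (N q)) (Fin (N q)) ℂ) (q q' : ℕ) :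
    Matrix (Fin (N q')) (Fin (N q)) ℂ :=
  net.B (fun j => (Fhat j)ᴴ) q q'

/-- The equivalent dual channel `Ĥ_{l,k} = H_0^l† B̂_{1,Q}† H_Q^k†`. -/
def dualH (net : RelayNet L Q nT nR N) (Fhat : ∀ q, Matrix (Fin (N q)) (Fin (N q)) ℂ)
    (l k : Fin L) : Matrix (Fin (nT l)) (Fin (nR k)) ℂ :=
  (net.H0 l)ᴴ * (net.Bhat Fhat 1 Q)ᴴ * (net.HQ k)ᴴ

/-- The covariance `Σ̂_q^R` of the transmit signal at relay cluster `q` in the dual network. -/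
def dualRelayCov (net : RelayNet L Q nT nR N)
    (Shat : ∀ l, Matrix (Fin (nR l)) (Fin (nR l)) ℂ)
    (Fhat : ∀ q, Matrix (Fin (N q)) (Fin (N q)) ℂ) (q : ℕ) : Matrix (Fin (N q)) (Fin (N q)) ℂ :=
  ∑ l, (net.Bhat Fhat q Q)ᴴ * (net.HQ l)ᴴ * Shat l * net.HQ l * net.Bhat Fhat q Q
    + ∑ q' ∈ Finset.Icc q Q, (net.Bhat Fhat q q')ᴴ * net.What q' * net.Bhat Fhat q q'

/-- The interference-plus-noise covariance `Ω̂_l` at the destination of dual link `l`. -/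
def dualΩ (net : RelayNet L Q nT nR N) (Shat : ∀ l, Matrix (Fin (nR l)) (Fin (nR l)) ℂ)
    (Fhat : ∀ q, Matrix (Fin (N q)) (Fin (N q)) ℂ) (l : Fin L) :
    Matrix (Fin (nT l)) (Fin (nT l)) ℂ :=
  net.WhatS l
    + ∑ q ∈ Finset.Icc 1 Q,
        (net.H0 l)ᴴ * (net.Bhat Fhat 1 q)ᴴ * net.What q * net.Bhat Fhat 1 q * net.H0 l
    + ∑ k, (net.Φ k l : ℂ) • (net.dualH Fhat l k * Shat k * (net.dualH Fhat l k)ᴴ)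

/-- The rate `log |I + Ĥ_{l,l} Σ̂_l Ĥ_{l,l}† Ω̂_l⁻¹|` of dual link `l`. -/
def dualRate (net : RelayNet L Q nT nR N) (Shat : ∀ l, Matrix (Fin (nR l)) (Fin (nR l)) ℂ)
    (Fhat : ∀ q, Matrix (Fin (N q)) (Fin (N q)) ℂ) (l : Fin L) : ℝ :=
  Real.log
    (1 + net.dualH Fhat l l * Shat l * (net.dualH Fhat l l)ᴴ * (net.dualΩ Shat Fhat l)⁻¹).det.re

/-- The dual linear cost `∑_l Tr(Σ̂_l W_{Q+1}^l) + ∑_q Tr(Σ̂_q^R W_q)`. -/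
def dualCost (net : RelayNet L Q nT nR N) (Shat : ∀ l, Matrix (Fin (nR l)) (Fin (nR l)) ℂ)
    (Fhat : ∀ q, Matrix (Fin (N q)) (Fin (N q)) ℂ) : ℝ :=
  ∑ l, (Shat l * net.WD l).trace.re
    + ∑ q ∈ Finset.Icc 1 Q, (net.dualRelayCov Shat Fhat q * net.W q).trace.re

/-- The network whose dual is the scaled dual network with scaling vector `d`: since the matrices
`Ŵ` only enter as noise covariances of the dual, replacing `Ŵ_q` by `d_{q+1} Ŵ_q` and `Ŵ_0^l` by
`d_1 Ŵ_0^l` scales exactly the noise of the dual network. -/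
def scaleDualNoise (net : RelayNet L Q nT nR N) (d : ℕ → ℝ) : RelayNet L Q nT nR N :=
  { net with
    What := fun q => (d (q + 1) : ℂ) • net.What q
    WhatS := fun l => (d 1 : ℂ) • net.WhatS l }

end RelayNet

end

/-! ### Quadratic forms and determinants of complex matrices -/

namespace Matrix

variable {n m ι : Type*} [Fintype n] [Fintype m]

/-! For fixed precoders the relay network acts as a one-hop network with channels `Hcheck`, noise
`W'` and constraint matrices `scaledWhat'`, and the scaled relay dual acts as the dual of that
network. The rates can therefore be compared one hop at a time; only the costs remember the relays.

In one hop, write `A = D⁻¹ - Ψ`. By the definition of the SINRs, `A p` is the vector of noise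
powers, which is positive. Since `A` has nonpositive off-diagonal entries, it is a nonsingular
M-matrix, so `Aᵀ q = n̂` has a unique solution, and it is nonnegative.

The chain rule `PosDef.det_add_sum_vecMulVec` turns each rate determinant into a product of factors
one plus MMSE-SIC SINR. Transposing `Ψ` reverses the decoding order. The equation for `q` says that
the dual streams, received with the vectors `t`, have the forward SINRs (`q_div_eq`); by
Cauchy–Schwarz the dual MMSE receivers do at least as well (`sinr_le_dual`). The one-hop costs agree
because both equal `qᵀ A p` (`cost_eq`).

Finally, by cyclicity of the trace, the relay cost on either side is the one-hop cost plus the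
weighted power of relay noise seen at later clusters. This extra term is the same double sum in the
two directions (`dualCost_eq_sum_Ptx`). -/

theorem star_dotProduct_conjTranspose_mulVec (K : Matrix m n ℂ) (x : m → ℂ) (y : n → ℂ) :
    star y ⬝ᵥ (Kᴴ *ᵥ x) = star (star x ⬝ᵥ (K *ᵥ y)) := by
  rw [← star_dotProduct, star_mulVec, ← dotProduct_mulVec]

/-- The quadratic form of a Hermitian matrix is real. -/
theorem IsHermitian.ofReal_re_quadForm {K : Matrix n n ℂ} (hK : K.IsHermitian) (x : n → ℂ) :
    (((star x ⬝ᵥ (K *ᵥ x)).re : ℝ) : ℂ) = star x ⬝ᵥ (K *ᵥ x) := by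
  apply Complex.conj_eq_iff_re.mp
  rw [starRingEnd_apply, ← star_dotProduct_conjTranspose_mulVec, hK.eq]

theorem PosDef.re_quadForm_pos {K : Matrix n n ℂ} (hK : K.PosDef) {x : n → ℂ} (hx : x ≠ 0) :
    0 < (star x ⬝ᵥ (K *ᵥ x)).re :=
  (Complex.pos_iff.mp (hK.dotProduct_mulVec_pos hx)).1

theorem PosSemidef.re_quadForm_nonneg {K : Matrix n n ℂ} (hK : K.PosSemidef) (x : n → ℂ) :
    0 ≤ (star x ⬝ᵥ (K *ᵥ x)).re :=
  (Complex.nonneg_iff.mp (hK.dotProduct_mulVec_nonneg x)).1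

theorem posSemidef_ofReal_smul_vecMulVec {p : ℝ} (hp : 0 ≤ p) (h : n → ℂ) :
    ((p : ℂ) • vecMulVec h (star h)).PosSemidef :=
  (posSemidef_vecMulVec_self_star h).smul (by exact_mod_cast hp)

theorem exists_smul_norm_one {x : n → ℂ} (hx : x ≠ 0) :
    ∃ α : ℂ, ∑ i, ‖(α • x) i‖ ^ 2 = 1 := by
  have h0 : ‖WithLp.toLp 2 x‖ ≠ 0 := by simpa using hx
  have hx2 : ∑ i, ‖x i‖ ^ 2 = ‖WithLp.toLp 2 x‖ ^ 2 := by rw [EuclideanSpace.norm_sq_eq]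
  refine ⟨((‖WithLp.toLp 2 x‖⁻¹ : ℝ) : ℂ), ?_⟩
  simp only [Pi.smul_apply, smul_eq_mul, norm_mul, mul_pow, ← Finset.mul_sum, hx2]
  rw [Complex.norm_real, norm_inv, norm_norm, ← mul_pow, inv_mul_cancel₀ h0, one_pow]

/-- A positive semidefinite matrix is a positive combination of projections to unit vectors. -/
theorem PosSemidef.exists_eq_sum_smul_vecMulVec {S : Matrix n n ℂ} (hS : S.PosSemidef) :
    ∃ (M : ℕ) (p : Fin M → ℝ) (t : Fin M → n → ℂ), (∀ m, 0 < p m) ∧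
      (∀ m, ∑ i, ‖t m i‖ ^ 2 = 1) ∧ S = ∑ m, (p m : ℂ) • vecMulVec (t m) (star (t m)) := by
  classical
  obtain ⟨k, v, rfl⟩ := posSemidef_iff_eq_sum_vecMulVec.mp hS
  -- Zero vectors cannot be normalized and are dropped; rescaling `v i` by `α i` is compensated by
  -- the power `‖α i‖⁻²`.
  choose α hα using fun i : {i // v i ≠ 0} => exists_smul_norm_one i.2
  have hα0 : ∀ i, α i ≠ 0 := fun i h => by simpa [h] using hα i
  let e := Fintype.equivFin {i // v i ≠ 0}
  refine ⟨_, fun m => (‖α (e.symm m)‖ ^ 2)⁻¹, fun m => α (e.symm m) • v (e.symm m),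
    fun m => by have := norm_pos_iff.mpr (hα0 (e.symm m)); positivity, fun m => hα _, ?_⟩
  have hterm : ∀ i : {i // v i ≠ 0}, (((‖α i‖ ^ 2)⁻¹ : ℝ) : ℂ) •
      vecMulVec (α i • v i) (star (α i • v i)) = vecMulVec (v i) (star (v i)) := fun i => by
    rw [star_smul, smul_vecMulVec, vecMulVec_smul, smul_smul, smul_smul, mul_assoc,
      Complex.star_def, Complex.mul_conj, Complex.normSq_eq_norm_sq, ← Complex.ofReal_mul,
      inv_mul_cancel₀ (pow_ne_zero 2 (norm_ne_zero_iff.mpr (hα0 i))), Complex.ofReal_one, one_smul]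
  simp only [hterm]
  rw [e.symm.sum_comp (fun i : {i // v i ≠ 0} => vecMulVec (v i) (star (v i))),
    ← Finset.sum_subtype (Finset.univ.filter fun i => v i ≠ 0) (by simp)
      (fun i => vecMulVec (v i) (star (v i)))]
  symm
  exact Finset.sum_filter_of_ne fun i _ hi h => hi (by rw [h, zero_vecMulVec])

variable [DecidableEq n]

theorem PosDef.mulVec_nonsing_inv_mulVec {K : Matrix n n ℂ} (hK : K.PosDef) (h : n → ℂ) :
    K *ᵥ (K⁻¹ *ᵥ h) = h := by
  rw [mulVec_mulVec, mul_nonsing_inv _ ((isUnit_iff_isUnit_det _).mp hK.isUnit), one_mulVec]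

/-- The determinant of a rank one update. -/
theorem PosDef.det_add_smul_vecMulVec {K : Matrix n n ℂ} (hK : K.PosDef) (p : ℝ) (h : n → ℂ) :
    (K + (p : ℂ) • vecMulVec h (star h)).det =
      K.det * ((1 + p * (star h ⬝ᵥ (K⁻¹ *ᵥ h)).re : ℝ) : ℂ) := by
  have hu := (isUnit_iff_isUnit_det _).mp hK.isUnit
  have := det_add_replicateCol_mul_replicateRow (ι := Unit) hu ((p : ℂ) • h) (star h)
  rw [← vecMulVec_eq, smul_vecMulVec] at this
  rw [this]
  congr 1
  push_cast
  rw [hK.inv.isHermitian.ofReal_re_quadForm, det_unique]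
  simp only [add_apply, one_apply_eq]
  congr 1
  rw [Matrix.mul_assoc, ← replicateCol_mulVec, replicateRow_mul_replicateCol_apply, mulVec_smul,
    dotProduct_smul, smul_eq_mul]

/-- The Cauchy–Schwarz inequality for the forms of a positive definite matrix and its inverse. -/
theorem PosDef.norm_sq_dotProduct_le {K : Matrix n n ℂ} (hK : K.PosDef) (r h : n → ℂ) :
    ‖star r ⬝ᵥ h‖ ^ 2 ≤ (star r ⬝ᵥ (K *ᵥ r)).re * (star h ⬝ᵥ (K⁻¹ *ᵥ h)).re := by
  rcases eq_or_ne h 0 with rfl | hh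
  · simp
  set g := K⁻¹ *ᵥ h with hg
  have hKg : K *ᵥ g = h := hK.mulVec_nonsing_inv_mulVec h
  have hγ : 0 < (star h ⬝ᵥ g).re := hK.inv.re_quadForm_pos hh
  have hγ' : (((star h ⬝ᵥ g).re : ℝ) : ℂ) = star h ⬝ᵥ g :=
    hK.inv.isHermitian.ofReal_re_quadForm h
  have hρ' := hK.isHermitian.ofReal_re_quadForm r
  set γ := (star h ⬝ᵥ g).re
  set ρ := (star r ⬝ᵥ (K *ᵥ r)).re
  have hgh : star g ⬝ᵥ h = γ := by
    rw [star_dotProduct, ← hγ', Complex.star_def, Complex.conj_ofReal]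
  have hgr : star g ⬝ᵥ (K *ᵥ r) = star (star r ⬝ᵥ h) := by
    rw [← hKg, ← star_dotProduct_conjTranspose_mulVec, hK.isHermitian.eq]
  set b := star r ⬝ᵥ h
  -- This is `γ` times the component of `r` that is `K`-orthogonal to `g = K⁻¹ h`; the scaling
  -- avoids a division.
  have key := hK.posSemidef.re_quadForm_nonneg ((γ : ℂ) • r - star b • g)
  have : star ((γ : ℂ) • r - star b • g) ⬝ᵥ (K *ᵥ ((γ : ℂ) • r - star b • g)) =
      ((γ * (ρ * γ - ‖b‖ ^ 2) : ℝ) : ℂ) := by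
    have hb : b * star b = ((‖b‖ ^ 2 : ℝ) : ℂ) := by
      rw [Complex.star_def, Complex.mul_conj, Complex.normSq_eq_norm_sq]
    simp only [mulVec_sub, mulVec_smul, star_sub, star_smul, sub_dotProduct, dotProduct_sub,
      smul_dotProduct, dotProduct_smul, hKg, hgh, hgr, smul_eq_mul, ← hρ', star_star]
    rw [show star r ⬝ᵥ h = b from rfl]
    push_cast at hb ⊢
    rw [← hb]
    simp only [Complex.star_def, Complex.conj_ofReal]
    ring
  rw [this, Complex.ofReal_re] at key
  nlinarith [nonneg_of_mul_nonneg_right key hγ]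

/-- The MMSE vector attains equality in `PosDef.norm_sq_dotProduct_le`. -/
theorem PosDef.norm_sq_dotProduct_eq {K : Matrix n n ℂ} (hK : K.PosDef) (h : n → ℂ) (α : ℂ) :
    ‖star (α • (K⁻¹ *ᵥ h)) ⬝ᵥ h‖ ^ 2 =
      (star (α • (K⁻¹ *ᵥ h)) ⬝ᵥ (K *ᵥ (α • (K⁻¹ *ᵥ h)))).re * (star h ⬝ᵥ (K⁻¹ *ᵥ h)).re := by
  have hγ' := hK.inv.isHermitian.ofReal_re_quadForm h
  have hgh : star (K⁻¹ *ᵥ h) ⬝ᵥ h = ((star h ⬝ᵥ (K⁻¹ *ᵥ h)).re : ℂ) := by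
    rw [star_dotProduct, ← hγ', Complex.star_def, Complex.conj_ofReal, Complex.ofReal_re]
  rw [mulVec_smul, hK.mulVec_nonsing_inv_mulVec, dotProduct_smul, star_smul, smul_dotProduct, hgh]
  set γ := (star h ⬝ᵥ (K⁻¹ *ᵥ h)).re
  have : α • star α • (γ : ℂ) = ((‖α‖ ^ 2 * γ : ℝ) : ℂ) := by
    rw [smul_smul, Complex.star_def, Complex.mul_conj, Complex.normSq_eq_norm_sq, smul_eq_mul]
    push_cast; rfl
  rw [this, Complex.ofReal_re, smul_eq_mul, norm_mul, norm_star, mul_pow, Complex.norm_real,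
    Real.norm_eq_abs, sq_abs]
  ring

/-- The chain rule for the log-determinant: successive rank one updates, those with smaller
index first. -/
theorem PosDef.det_add_sum_vecMulVec [LinearOrder ι] {K : Matrix n n ℂ} (hK : K.PosDef)
    {p : ι → ℝ} (hp : ∀ i, 0 ≤ p i) (h : ι → n → ℂ) (s : Finset ι) :
    (K + ∑ i ∈ s, (p i : ℂ) • vecMulVec (h i) (star (h i))).det = K.det *
      ((∏ i ∈ s, (1 + p i * (star (h i) ⬝ᵥ ((K + ∑ j ∈ s with j < i,
        (p j : ℂ) • vecMulVec (h j) (star (h j)))⁻¹ *ᵥ h i)).re) : ℝ) : ℂ) := by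
  induction s using Finset.induction_on_max with
  | empty => simp
  | insert a s hs ih =>
    have ha : a ∉ s := fun h => lt_irrefl _ (hs a h)
    rw [Finset.sum_insert ha, add_comm (_ • _), ← add_assoc,
      (hK.add_posSemidef (posSemidef_sum _ fun i _ =>
        posSemidef_ofReal_smul_vecMulVec (hp i) (h i))).det_add_smul_vecMulVec, ih,
      Finset.prod_insert ha, Finset.filter_insert, if_neg (lt_irrefl a),
      Finset.filter_true_of_mem hs, mul_assoc, ← Complex.ofReal_mul,
      mul_comm (1 + _) (∏ i ∈ s, (_ : ℝ))]
    -- The new maximum `a` is the last update, so the covariances seen by the earlier indices do not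
    -- change.
    have hfilter : ∀ i ∈ s, ((insert a s).filter fun j => j < i) = s.filter fun j => j < i :=
      fun i hi => by rw [Finset.filter_insert, if_neg (hs i hi).not_gt]
    rw [Finset.prod_congr rfl fun i hi => by rw [← hfilter i hi]]

/-- The rate of a point-to-point channel as a product over streams. -/
theorem PosDef.det_one_add_sum_mul_inv [LinearOrder ι] [Fintype ι] {K : Matrix n n ℂ}
    (hK : K.PosDef) {p : ι → ℝ} (hp : ∀ i, 0 ≤ p i) (h : ι → n → ℂ) :
    (1 + (∑ i, (p i : ℂ) • vecMulVec (h i) (star (h i))) * K⁻¹).det.re =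
      ∏ i, (1 + p i * (star (h i) ⬝ᵥ ((∑ j with j < i,
        (p j : ℂ) • vecMulVec (h j) (star (h j)) + K)⁻¹ *ᵥ h i)).re) := by
  have hu := (isUnit_iff_isUnit_det _).mp hK.isUnit
  have hK0 : K.det ≠ 0 := hu.ne_zero
  have := hK.det_add_sum_vecMulVec hp h Finset.univ
  -- Factoring out `K` on the right lets `det K` cancel from the chain rule.
  rw [show K + ∑ i, (p i : ℂ) • vecMulVec (h i) (star (h i)) =
    (1 + (∑ i, (p i : ℂ) • vecMulVec (h i) (star (h i))) * K⁻¹) * K by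
      rw [add_mul, one_mul, Matrix.mul_assoc, nonsing_inv_mul _ hu, mul_one], det_mul,
      mul_comm] at this
  rw [mul_left_cancel₀ hK0 this, Complex.ofReal_re]
  simp only [add_comm K]

/-- The decoding order of the dual links. -/
theorem PosDef.det_one_add_sum_mul_inv_Iio {M : ℕ} {K : Matrix n n ℂ}
    (hK : K.PosDef) {p : Fin M → ℝ} (hp : ∀ i, 0 ≤ p i) (h : Fin M → n → ℂ) :
    (1 + (∑ i, (p i : ℂ) • vecMulVec (h i) (star (h i))) * K⁻¹).det.re =
      ∏ i, (1 + p i * (star (h i) ⬝ᵥ ((∑ j ∈ Finset.Iio i,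
        (p j : ℂ) • vecMulVec (h j) (star (h j)) + K)⁻¹ *ᵥ h i)).re) := by
  rw [hK.det_one_add_sum_mul_inv hp h]
  simp only [Finset.filter_gt_eq_Iio]

/-- The decoding order of the forward links, obtained from the chain rule over the order dual of
`Fin M`. -/
theorem PosDef.det_one_add_sum_mul_inv_Ioi {M : ℕ} {K : Matrix n n ℂ}
    (hK : K.PosDef) {p : Fin M → ℝ} (hp : ∀ i, 0 ≤ p i) (h : Fin M → n → ℂ) :
    (1 + (∑ i, (p i : ℂ) • vecMulVec (h i) (star (h i))) * K⁻¹).det.re =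
      ∏ i, (1 + p i * (star (h i) ⬝ᵥ ((∑ j ∈ Finset.Ioi i,
        (p j : ℂ) • vecMulVec (h j) (star (h j)) + K)⁻¹ *ᵥ h i)).re) := by
  have := hK.det_one_add_sum_mul_inv (ι := (Fin M)ᵒᵈ) (p := p) hp h
  simp only [← Finset.filter_lt_eq_Ioi]
  exact this

/-! ### Matrices with nonpositive off-diagonal entries -/

variable {A : Matrix n n ℝ} {p : n → ℝ}

omit [DecidableEq n] in
/-- A matrix with nonpositive off-diagonal entries that maps a positive vector to a positive vector
is monotone. -/
theorem nonneg_of_mulVec_nonneg (hA : ∀ i j, i ≠ j → A i j ≤ 0) (hp : ∀ i, 0 < p i)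
    (hAp : ∀ i, 0 < (A *ᵥ p) i) {y : n → ℝ} (hy : ∀ i, 0 ≤ (A *ᵥ y) i) (i : n) : 0 ≤ y i := by
  by_contra! hi
  -- At an index minimizing `y j / p j`, with value `c < 0`, one has `y ≥ c p` with equality at `a`.
  -- The signs in row `a` then give `(A y) a ≤ c (A p) a < 0`.
  obtain ⟨a, -, ha⟩ := Finset.exists_min_image Finset.univ (fun j => y j / p j) ⟨i, Finset.mem_univ i⟩
  set c := y a / p a with hc
  have hc0 : c < 0 := (ha i (Finset.mem_univ i)).trans_lt (div_neg_of_neg_of_pos hi (hp i))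
  have hle : (A *ᵥ y) a ≤ c * (A *ᵥ p) a := by
    rw [mulVec, mulVec, dotProduct, dotProduct, Finset.mul_sum]
    refine Finset.sum_le_sum fun j _ => ?_
    rcases eq_or_ne a j with rfl | haj
    · exact (show A a a * y a = c * (A a a * p a) by
        rw [hc]; field_simp [(hp a).ne']).le
    · have := (le_div_iff₀ (hp j)).mp (ha j (Finset.mem_univ j))
      nlinarith [mul_le_mul_of_nonpos_left this (hA a j haj)]
  exact absurd (hy a) (not_le.mpr (hle.trans_lt (mul_neg_of_neg_of_pos hc0 (hAp a))))

/-- Monotonicity applies to both `v` and `-v` for a kernel vector `v`, which forces `v = 0`. -/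
theorem isUnit_det_of_mulVec_pos (hA : ∀ i j, i ≠ j → A i j ≤ 0) (hp : ∀ i, 0 < p i)
    (hAp : ∀ i, 0 < (A *ᵥ p) i) : IsUnit A.det := by
  rw [isUnit_iff_ne_zero]
  intro h
  obtain ⟨v, hv, hAv⟩ := exists_mulVec_eq_zero_iff.mpr h
  refine hv (funext fun i => le_antisymm ?_ (nonneg_of_mulVec_nonneg hA hp hAp (by simp [hAv]) i))
  simpa using nonneg_of_mulVec_nonneg hA hp hAp (y := -v) (by simp [mulVec_neg, hAv]) i

/-- `A` maps each column of `A⁻¹` to a standard basis vector, so by monotonicity `A⁻¹` is entrywise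
nonnegative, and so is its transpose. The positive test vector is thus needed for `A` only. -/
theorem transpose_inv_mulVec_nonneg (hA : ∀ i j, i ≠ j → A i j ≤ 0) (hp : ∀ i, 0 < p i)
    (hAp : ∀ i, 0 < (A *ᵥ p) i) {b : n → ℝ} (hb : ∀ i, 0 ≤ b i) (i : n) :
    0 ≤ ((Aᵀ)⁻¹ *ᵥ b) i := by
  rw [← transpose_nonsing_inv, mulVec, dotProduct]
  refine Finset.sum_nonneg fun j _ => mul_nonneg ?_ (hb j)
  have h := nonneg_of_mulVec_nonneg hA hp hAp (y := A⁻¹ *ᵥ Pi.single i 1) (fun k => ?_) j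
  · simpa using h
  · rw [mulVec_mulVec, mul_nonsing_inv _ (isUnit_det_of_mulVec_pos hA hp hAp), one_mulVec,
      Pi.single_apply]
    split_ifs <;> norm_num

end Matrix

open Matrix

/-! ### One-hop networks -/

namespace IFNet

variable {L : ℕ} {nT nR : Fin L → ℕ}

/-- The dual network: reversed directions, noise and constraint matrices interchanged. -/
def dual (G : IFNet L nT nR) : IFNet L nR nT where
  H l k := (G.H k l)ᴴ
  W := G.What
  What := G.W
  Φ := G.Φᵀ

/-- The rate of link `l`. -/
noncomputable def rate (G : IFNet L nT nR) (S : ∀ l, Matrix (Fin (nT l)) (Fin (nT l)) ℂ)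
    (l : Fin L) : ℝ :=
  Real.log (1 + G.H l l * S l * (G.H l l)ᴴ * (G.Ω S l)⁻¹).det.re

/-- The standing assumptions under which the covariance transformation is well defined. -/
structure Regular (G : IFNet L nT nR) : Prop where
  W_posDef : ∀ l, (G.W l).PosDef
  What_posDef : ∀ l, (G.What l).PosDef
  Φ_nonneg : ∀ l k, 0 ≤ G.Φ l k
  Φ_diag : ∀ l, G.Φ l l = 0

theorem Regular.dual {G : IFNet L nT nR} (hG : G.Regular) : G.dual.Regular :=
  ⟨hG.What_posDef, hG.W_posDef, fun l k => hG.Φ_nonneg k l, hG.Φ_diag⟩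

theorem Regular.Ω_posDef {G : IFNet L nT nR} (hG : G.Regular)
    {S : ∀ l, Matrix (Fin (nT l)) (Fin (nT l)) ℂ} (hS : ∀ l, (S l).PosSemidef) (l : Fin L) :
    (G.Ω S l).PosDef :=
  (hG.W_posDef l).add_posSemidef (posSemidef_sum _ fun k _ =>
    ((hS k).mul_mul_conjTranspose_same _).smul (by exact_mod_cast hG.Φ_nonneg l k))

end IFNet

/-! ### Quadratic forms, traces and congruences of sums of rank one matrices -/

namespace Matrix

variable {m n : Type*} [Fintype n]

theorem mul_vecMulVec_star_mul_conjTranspose (H : Matrix m n ℂ) (t : n → ℂ) :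
    H * vecMulVec t (star t) * Hᴴ = vecMulVec (H *ᵥ t) (star (H *ᵥ t)) := by
  rw [mul_vecMulVec, vecMulVec_mul, star_mulVec]

theorem re_quadForm_smul_vecMulVec (c : ℝ) (x h : n → ℂ) :
    (star x ⬝ᵥ (((c : ℂ) • vecMulVec h (star h)) *ᵥ x)).re = c * ‖star x ⬝ᵥ h‖ ^ 2 := by
  rw [smul_mulVec, dotProduct_smul, vecMulVec_mulVec, smul_eq_mul, Complex.re_ofReal_mul]
  congr 1
  rw [op_smul_eq_smul, dotProduct_smul, smul_eq_mul, star_dotProduct h x, mul_comm,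
    Complex.star_def, Complex.mul_conj, Complex.ofReal_re, Complex.normSq_eq_norm_sq]

theorem re_trace_sum_smul_vecMulVec_mul {ι : Type*} [Fintype ι] (c : ι → ℝ) (h : ι → n → ℂ)
    (K : Matrix n n ℂ) :
    ((∑ i, (c i : ℂ) • vecMulVec (h i) (star (h i))) * K).trace.re =
      ∑ i, c i * (star (h i) ⬝ᵥ (K *ᵥ h i)).re := by
  rw [Finset.sum_mul, trace_sum, Complex.re_sum]
  refine Finset.sum_congr rfl fun i _ => ?_
  rw [smul_mul, trace_smul, smul_eq_mul, Complex.re_ofReal_mul, vecMulVec_mul, trace_vecMulVec,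
    dotProduct_comm, dotProduct_mulVec]

theorem mul_sum_smul_vecMulVec_mul {ι : Type*} [Fintype ι] (c : ι → ℝ) (h : ι → n → ℂ)
    (H : Matrix m n ℂ) :
    H * (∑ i, (c i : ℂ) • vecMulVec (h i) (star (h i))) * Hᴴ =
      ∑ i, (c i : ℂ) • vecMulVec (H *ᵥ h i) (star (H *ᵥ h i)) := by
  rw [Matrix.mul_sum, Matrix.sum_mul]
  refine Finset.sum_congr rfl fun i _ => ?_
  rw [Matrix.mul_smul, Matrix.smul_mul, mul_vecMulVec_star_mul_conjTranspose]

end Matrix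

/-! ### Power equations and SINR duality for streams -/

namespace Streams

variable {L : ℕ} {nT nR : Fin L → ℕ} (s : Streams L nT nR) (G : IFNet L nT nR)
  {S : ∀ l, Matrix (Fin (nT l)) (Fin (nT l)) ℂ}

theorem Ψ_self (l : Fin L) (m n : Fin (s.M l)) :
    s.Ψ G ⟨l, m⟩ ⟨l, n⟩ = if m < n then s.gain G ⟨l, m⟩ ⟨l, n⟩ else 0 := by
  simp [Ψ]

theorem Ψ_of_ne {a b : s.Idx} (h : b.1 ≠ a.1) : s.Ψ G a b = G.Φ a.1 b.1 * s.gain G a b := by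
  simp [Ψ, h]

theorem gain_nonneg (a b : s.Idx) : 0 ≤ s.gain G a b := sq_nonneg _

variable {G}

theorem Ψ_nonneg (hG : G.Regular) (a b : s.Idx) : 0 ≤ s.Ψ G a b := by
  unfold Ψ
  split_ifs
  · exact s.gain_nonneg G a b
  · exact le_rfl
  · exact mul_nonneg (hG.Φ_nonneg _ _) (s.gain_nonneg G a b)

/-- Because `Φ` vanishes on the diagonal, the sum over links may include `l` itself and so matches
the shape of `Ω`. -/
theorem sum_Ψ_mul (hG : G.Regular) (x : s.Idx → ℝ) (l : Fin L) (m : Fin (s.M l)) :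
    ∑ b, s.Ψ G ⟨l, m⟩ b * x b =
      ∑ n ∈ Finset.Ioi m, x ⟨l, n⟩ * s.gain G ⟨l, m⟩ ⟨l, n⟩ +
        ∑ k, G.Φ l k * ∑ n, x ⟨k, n⟩ * s.gain G ⟨l, m⟩ ⟨k, n⟩ := by
  rw [Fintype.sum_sigma, ← Finset.add_sum_erase _ _ (Finset.mem_univ l),
    ← Finset.add_sum_erase (a := l) _ (fun k => G.Φ l k * _) (Finset.mem_univ l), hG.Φ_diag,
    zero_mul, zero_add]
  congr 1
  · rw [← Finset.filter_lt_eq_Ioi, Finset.sum_filter]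
    refine Finset.sum_congr rfl fun n _ => ?_
    rw [Ψ_self, ite_mul, zero_mul, mul_comm]
  · refine Finset.sum_congr rfl fun k hk => ?_
    rw [Finset.mul_sum]
    refine Finset.sum_congr rfl fun n _ => ?_
    rw [s.Ψ_of_ne G (a := ⟨l, m⟩) (b := ⟨k, n⟩) (Finset.ne_of_mem_erase hk)]
    ring

/-- Along a column the order within a link is reversed: `Ioi` becomes `Iio`. This is where the dual
decoding order comes from. -/
theorem sum_mul_Ψ (hG : G.Regular) (x : s.Idx → ℝ) (l : Fin L) (m : Fin (s.M l)) :
    ∑ b, s.Ψ G b ⟨l, m⟩ * x b =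
      ∑ n ∈ Finset.Iio m, x ⟨l, n⟩ * s.gain G ⟨l, n⟩ ⟨l, m⟩ +
        ∑ k, G.Φ k l * ∑ n, x ⟨k, n⟩ * s.gain G ⟨k, n⟩ ⟨l, m⟩ := by
  rw [Fintype.sum_sigma, ← Finset.add_sum_erase _ _ (Finset.mem_univ l),
    ← Finset.add_sum_erase (a := l) _ (fun k => G.Φ k l * _) (Finset.mem_univ l), hG.Φ_diag,
    zero_mul, zero_add]
  congr 1
  · rw [← Finset.filter_gt_eq_Iio, Finset.sum_filter]
    refine Finset.sum_congr rfl fun n _ => ?_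
    rw [Ψ_self, ite_mul, zero_mul, mul_comm]
  · refine Finset.sum_congr rfl fun k hk => ?_
    rw [Finset.mul_sum]
    refine Finset.sum_congr rfl fun n _ => ?_
    rw [s.Ψ_of_ne G (a := ⟨k, n⟩) (b := ⟨l, m⟩) (Finset.ne_of_mem_erase hk).symm]
    ring

/-- The covariance that the streams `i < m` of dual link `l`, together with the
interference-plus-noise, produce at its receiver. -/
noncomputable def dualSicCov (s : Streams L nT nR) (G : IFNet L nT nR) (l : Fin L)
    (m : Fin (s.M l)) : Matrix (Fin (nT l)) (Fin (nT l)) ℂ :=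
  ∑ i ∈ Finset.Iio m, (s.q G ⟨l, i⟩ : ℂ) •
      vecMulVec ((G.H l l)ᴴ *ᵥ s.r l i) (star ((G.H l l)ᴴ *ᵥ s.r l i)) +
    G.dual.Ω (s.covTransform G) l

theorem gain_eq_dual (a b : s.Idx) :
    s.gain G a b = ‖star (s.t b.1 b.2) ⬝ᵥ ((G.H a.1 b.1)ᴴ *ᵥ s.r a.1 a.2)‖ ^ 2 := by
  rw [star_dotProduct_conjTranspose_mulVec, norm_star, gain]

variable {s}

namespace IsFor

theorem posSemidef (hs : s.IsFor G S) (l : Fin L) : (S l).PosSemidef := by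
  rw [hs.decomp l]
  exact posSemidef_sum _ fun m _ => posSemidef_ofReal_smul_vecMulVec (hs.power_pos l m).le _

theorem r_ne_zero (hs : s.IsFor G S) (l : Fin L) (m : Fin (s.M l)) : s.r l m ≠ 0 := fun h => by
  simpa [h] using hs.r_unit l m

theorem t_ne_zero (hs : s.IsFor G S) (l : Fin L) (m : Fin (s.M l)) : s.t l m ≠ 0 := fun h => by
  simpa [h] using hs.t_unit l m

theorem sicCov_posDef (hs : s.IsFor G S) (hG : G.Regular) (l : Fin L) (m : Fin (s.M l)) :
    (s.sicCov G S l m).PosDef := by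
  refine PosDef.posSemidef_add (posSemidef_sum _ fun i _ => ?_) (hG.Ω_posDef hs.posSemidef l)
  rw [mul_vecMulVec_star_mul_conjTranspose]
  exact posSemidef_ofReal_smul_vecMulVec (hs.power_pos l i).le _

/-- Links the scalar description through `Ψ` with the matrix description through covariances. -/
theorem inr_eq (hs : s.IsFor G S) (hG : G.Regular) (l : Fin L) (m : Fin (s.M l)) :
    s.inr G ⟨l, m⟩ = (star (s.r l m) ⬝ᵥ (s.sicCov G S l m *ᵥ s.r l m)).re := by
  rw [inr, s.sum_Ψ_mul hG (fun b => s.p b.1 b.2), sicCov, IFNet.Ω]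
  simp only [mul_vecMulVec_star_mul_conjTranspose, add_mulVec, sum_mulVec, dotProduct_add,
    dotProduct_sum, Complex.add_re, Complex.re_sum, re_quadForm_smul_vecMulVec]
  rw [add_assoc]
  refine congrArg₂ (· + ·) rfl ?_
  rw [add_comm]
  refine congrArg₂ (· + ·) rfl ?_
  refine Finset.sum_congr rfl fun k _ => ?_
  rw [hs.decomp k, mul_sum_smul_vecMulVec_mul, smul_mulVec, dotProduct_smul, smul_eq_mul,
    Complex.re_ofReal_mul, sum_mulVec, dotProduct_sum, Complex.re_sum]
  simp only [re_quadForm_smul_vecMulVec]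
  rfl

theorem inr_pos (hs : s.IsFor G S) (hG : G.Regular) (a : s.Idx) : 0 < s.inr G a :=
  add_pos_of_nonneg_of_pos
    (Finset.sum_nonneg fun b _ => mul_nonneg (s.Ψ_nonneg hG a b) (hs.power_pos _ _).le)
    ((hG.W_posDef a.1).re_quadForm_pos (hs.r_ne_zero _ _))

theorem dEntry_pos (hs : s.IsFor G S) (hG : G.Regular) (a : s.Idx) : 0 < s.dEntry G a := by
  rw [dEntry_eq]
  exact div_pos (hs.power_pos _ _) (hs.inr_pos hG a)

/-- The coefficient matrix of the linear system for the transmit powers. -/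
theorem D_inv_sub_Ψ (hs : s.IsFor G S) (hG : G.Regular) :
    (s.D G)⁻¹ - s.Ψ G = diagonal (fun a => s.inr G a / s.p a.1 a.2) - s.Ψ G := by
  congr 1
  refine inv_eq_right_inv ?_
  rw [D, diagonal_mul_diagonal, ← diagonal_one]
  congr 1
  funext a
  have := hs.inr_pos hG a
  have := hs.power_pos a.1 a.2
  rw [dEntry_eq]
  field_simp

/-- `D⁻¹ p` is the interference plus noise and `Ψ p` the interference, so only the noise remains. -/
theorem D_inv_sub_Ψ_mulVec (hs : s.IsFor G S) (hG : G.Regular) (a : s.Idx) :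
    (((s.D G)⁻¹ - s.Ψ G) *ᵥ fun b => s.p b.1 b.2) a =
      (star (s.r a.1 a.2) ⬝ᵥ (G.W a.1 *ᵥ s.r a.1 a.2)).re := by
  rw [hs.D_inv_sub_Ψ hG, sub_mulVec, Pi.sub_apply, mulVec_diagonal,
    div_mul_cancel₀ _ (hs.power_pos _ _).ne', inr]
  exact add_sub_cancel_left _ _

theorem offDiag_nonpos (hs : s.IsFor G S) (hG : G.Regular) (a b : s.Idx) (hab : a ≠ b) :
    ((s.D G)⁻¹ - s.Ψ G) a b ≤ 0 := by
  rw [hs.D_inv_sub_Ψ hG, Matrix.sub_apply, diagonal_apply_ne _ hab, zero_sub, neg_nonpos]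
  exact s.Ψ_nonneg hG a b

theorem D_inv_sub_Ψ_mulVec_pos (hs : s.IsFor G S) (hG : G.Regular) (a : s.Idx) :
    0 < (((s.D G)⁻¹ - s.Ψ G) *ᵥ fun b => s.p b.1 b.2) a := by
  rw [hs.D_inv_sub_Ψ_mulVec hG]
  exact (hG.W_posDef a.1).re_quadForm_pos (hs.r_ne_zero _ _)

theorem D_inv_sub_Ψ_transpose :
    (s.D G)⁻¹ - (s.Ψ G)ᵀ = ((s.D G)⁻¹ - s.Ψ G)ᵀ := by
  rw [transpose_sub, transpose_nonsing_inv, D, diagonal_transpose]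

theorem isUnit_det (hs : s.IsFor G S) (hG : G.Regular) :
    IsUnit ((s.D G)⁻¹ - (s.Ψ G)ᵀ).det := by
  rw [D_inv_sub_Ψ_transpose, det_transpose]
  exact isUnit_det_of_mulVec_pos (hs.offDiag_nonpos hG) (fun b => hs.power_pos b.1 b.2)
    (hs.D_inv_sub_Ψ_mulVec_pos hG)

theorem nhat_pos (hs : s.IsFor G S) (hG : G.Regular) (a : s.Idx) : 0 < s.nhat G a :=
  (hG.What_posDef a.1).re_quadForm_pos (hs.t_ne_zero _ _)

theorem q_nonneg (hs : s.IsFor G S) (hG : G.Regular) (a : s.Idx) : 0 ≤ s.q G a := by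
  rw [q, D_inv_sub_Ψ_transpose]
  exact transpose_inv_mulVec_nonneg (hs.offDiag_nonpos hG) (fun b => hs.power_pos b.1 b.2)
    (hs.D_inv_sub_Ψ_mulVec_pos hG) (fun b => (hs.nhat_pos hG b).le) a

theorem covTransform_posSemidef (hs : s.IsFor G S) (hG : G.Regular) (l : Fin L) :
    (s.covTransform G l).PosSemidef :=
  posSemidef_sum _ fun _ _ => posSemidef_ofReal_smul_vecMulVec (hs.q_nonneg hG _) _

theorem transpose_mulVec_q (hs : s.IsFor G S) (hG : G.Regular) :
    ((s.D G)⁻¹ - s.Ψ G)ᵀ *ᵥ s.q G = s.nhat G := by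
  rw [q, ← D_inv_sub_Ψ_transpose, mulVec_mulVec, mul_nonsing_inv _ (hs.isUnit_det hG), one_mulVec]

theorem dualSicCov_posDef (hs : s.IsFor G S) (hG : G.Regular) (l : Fin L) (m : Fin (s.M l)) :
    (s.dualSicCov G l m).PosDef :=
  PosDef.posSemidef_add
    (posSemidef_sum _ fun _ _ => posSemidef_ofReal_smul_vecMulVec (hs.q_nonneg hG _) _)
    (hG.dual.Ω_posDef (hs.covTransform_posSemidef hG) l)

/-- The dual counterpart of `inr_eq`, with `t` in the role of the receive vector. -/
theorem quadForm_dualSicCov (hG : G.Regular) (l : Fin L)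
    (m : Fin (s.M l)) :
    (star (s.t l m) ⬝ᵥ (s.dualSicCov G l m *ᵥ s.t l m)).re =
      ∑ b, s.Ψ G b ⟨l, m⟩ * s.q G b + s.nhat G ⟨l, m⟩ := by
  rw [s.sum_mul_Ψ hG, dualSicCov, IFNet.Ω]
  simp only [add_mulVec, sum_mulVec, dotProduct_add,
    dotProduct_sum, Complex.add_re, Complex.re_sum, re_quadForm_smul_vecMulVec, gain_eq_dual]
  rw [add_assoc]
  refine congrArg₂ (· + ·) rfl ?_
  rw [add_comm]
  refine congrArg (· + s.nhat G ⟨l, m⟩) ?_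
  refine Finset.sum_congr rfl fun k _ => ?_
  rw [covTransform, mul_sum_smul_vecMulVec_mul, smul_mulVec, dotProduct_smul, smul_eq_mul,
    Complex.re_ofReal_mul, sum_mulVec, dotProduct_sum, Complex.re_sum]
  simp only [re_quadForm_smul_vecMulVec]
  rfl

/-- The reverse streams achieve the SINRs of the forward streams. -/
theorem q_div_eq (hs : s.IsFor G S) (hG : G.Regular) (l : Fin L) (m : Fin (s.M l)) :
    (star (s.t l m) ⬝ᵥ (s.dualSicCov G l m *ᵥ s.t l m)).re =
      s.inr G ⟨l, m⟩ / s.p l m * s.q G ⟨l, m⟩ := by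
  have h := congrFun (hs.transpose_mulVec_q hG) ⟨l, m⟩
  rw [hs.D_inv_sub_Ψ hG, transpose_sub, sub_mulVec, Pi.sub_apply, diagonal_transpose,
    mulVec_diagonal] at h
  rw [quadForm_dualSicCov hG, ← h]
  exact add_sub_cancel _ _

/-- The forward SINR is the one of the MMSE-SIC receiver. -/
theorem sinr_eq (hs : s.IsFor G S) (hG : G.Regular) (l : Fin L) (m : Fin (s.M l)) :
    s.sinr G ⟨l, m⟩ = s.p l m * (star (G.H l l *ᵥ s.t l m) ⬝ᵥ
      ((s.sicCov G S l m)⁻¹ *ᵥ (G.H l l *ᵥ s.t l m))).re := by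
  have hpos := hs.inr_pos hG ⟨l, m⟩
  rw [sinr, div_eq_iff hpos.ne', mul_assoc]
  congr 1
  rw [hs.inr_eq hG, gain]
  -- For a stream that is not received at all, both sides vanish whatever `r` is; otherwise `r` is
  -- the MMSE vector and Cauchy–Schwarz is an equality.
  by_cases h : G.H l l *ᵥ s.t l m = 0
  · simp [h]
  · obtain ⟨α, hα⟩ := hs.mmse l m h
    rw [hα, (hs.sicCov_posDef hG l m).norm_sq_dotProduct_eq, mul_comm]

theorem sinr_nonneg (hs : s.IsFor G S) (hG : G.Regular) (a : s.Idx) : 0 ≤ s.sinr G a :=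
  div_nonneg (mul_nonneg (hs.power_pos _ _).le (s.gain_nonneg G a a)) (hs.inr_pos hG a).le

/-- The vector `t l m` is one possible dual receiver, and Cauchy–Schwarz bounds it by the MMSE one.
Using `q_div_eq` without dividing by the gain also covers streams of zero gain. -/
theorem sinr_le_dual (hs : s.IsFor G S) (hG : G.Regular) (l : Fin L) (m : Fin (s.M l)) :
    s.sinr G ⟨l, m⟩ ≤ s.q G ⟨l, m⟩ * (star ((G.H l l)ᴴ *ᵥ s.r l m) ⬝ᵥ
      ((s.dualSicCov G l m)⁻¹ *ᵥ ((G.H l l)ᴴ *ᵥ s.r l m))).re := by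
  have hinr := hs.inr_pos hG ⟨l, m⟩
  have hp := hs.power_pos l m
  have h := (hs.dualSicCov_posDef hG l m).norm_sq_dotProduct_le (s.t l m) ((G.H l l)ᴴ *ᵥ s.r l m)
  rw [hs.q_div_eq hG, ← s.gain_eq_dual (G := G) ⟨l, m⟩ ⟨l, m⟩] at h
  rw [sinr, div_le_iff₀ hinr]
  refine (mul_le_mul_of_nonneg_left h hp.le).trans_eq ?_
  field_simp

theorem rate_eq (hs : s.IsFor G S) (hG : G.Regular) (l : Fin L) :
    G.rate S l = Real.log (∏ m, (1 + s.sinr G ⟨l, m⟩)) := by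
  rw [IFNet.rate]
  congr 1
  rw [hs.decomp l, mul_sum_smul_vecMulVec_mul,
    (hG.Ω_posDef hs.posSemidef l).det_one_add_sum_mul_inv_Ioi fun m => (hs.power_pos l m).le]
  refine Finset.prod_congr rfl fun m _ => ?_
  rw [hs.sinr_eq hG, sicCov]
  simp only [mul_vecMulVec_star_mul_conjTranspose]

/-- The covariance transformation does not decrease the rates. -/
theorem rate_le_dual_rate (hs : s.IsFor G S) (hG : G.Regular) (l : Fin L) :
    G.rate S l ≤ G.dual.rate (s.covTransform G) l := by
  rw [hs.rate_eq hG, IFNet.rate]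
  have h := (hG.dual.Ω_posDef (hs.covTransform_posSemidef hG) l).det_one_add_sum_mul_inv_Iio
    (p := fun m => s.q G ⟨l, m⟩) (fun m => hs.q_nonneg hG _) fun m => (G.H l l)ᴴ *ᵥ s.r l m
  rw [← mul_sum_smul_vecMulVec_mul] at h
  refine Real.log_le_log
    (Finset.prod_pos fun m _ => add_pos_of_pos_of_nonneg one_pos (hs.sinr_nonneg hG _)) ?_
  refine le_of_le_of_eq (Finset.prod_le_prod (fun m _ => add_nonneg zero_le_one
    (hs.sinr_nonneg hG _)) fun m _ => add_le_add_right (hs.sinr_le_dual hG l m) 1) h.symm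

/-- The covariance transformation preserves the linear cost. -/
theorem cost_eq (hs : s.IsFor G S) (hG : G.Regular) :
    ∑ l, (s.covTransform G l * G.W l).trace.re = ∑ l, (S l * G.What l).trace.re := by
  -- The bilinear form `qᵀ (D⁻¹ - Ψ) p` is evaluated from both sides: acting on `p` it yields the
  -- noise powers, acting on `q` it yields `n̂`.
  have h1 : ∑ l, (s.covTransform G l * G.W l).trace.re =
      s.q G ⬝ᵥ (((s.D G)⁻¹ - s.Ψ G) *ᵥ fun b => s.p b.1 b.2) := by
    rw [dotProduct, Fintype.sum_sigma]
    refine Finset.sum_congr rfl fun l _ => ?_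
    rw [covTransform, re_trace_sum_smul_vecMulVec_mul]
    exact Finset.sum_congr rfl fun m _ => by rw [hs.D_inv_sub_Ψ_mulVec hG]
  rw [h1, dotProduct_mulVec, ← mulVec_transpose, hs.transpose_mulVec_q hG, dotProduct,
    Fintype.sum_sigma]
  refine Finset.sum_congr rfl fun l _ => ?_
  rw [hs.decomp l, re_trace_sum_smul_vecMulVec_mul]
  exact Finset.sum_congr rfl fun m _ => mul_comm _ _

end IsFor

theorem exists_isFor (hG : G.Regular) (hnR : ∀ l, 1 ≤ nR l) (hS : ∀ l, (S l).PosSemidef) :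
    ∃ s : Streams L nT nR, s.IsFor G S := by
  choose M p t hp ht hdec using fun l => (hS l).exists_eq_sum_smul_vecMulVec
  let s₀ : Streams L nT nR := ⟨M, p, t, fun _ _ => 0⟩
  have hpd : ∀ l m, (s₀.sicCov G S l m).PosDef := fun l m => by
    refine PosDef.posSemidef_add (posSemidef_sum _ fun i _ => ?_) (hG.Ω_posDef hS l)
    rw [mul_vecMulVec_star_mul_conjTranspose]
    exact posSemidef_ofReal_smul_vecMulVec (hp l i).le _
  have hr : ∀ l m, ∃ r : Fin (nR l) → ℂ, ∑ i, ‖r i‖ ^ 2 = 1 ∧ (G.H l l *ᵥ t l m ≠ 0 →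
      ∃ α : ℂ, r = α • ((s₀.sicCov G S l m)⁻¹ *ᵥ (G.H l l *ᵥ t l m))) := fun l m => by
    by_cases h : G.H l l *ᵥ t l m = 0
    · have : NeZero (nR l) := ⟨Nat.one_le_iff_ne_zero.mp (hnR l)⟩
      obtain ⟨α, hα⟩ := exists_smul_norm_one (x := (Pi.single 0 1 : Fin (nR l) → ℂ)) (by simp)
      exact ⟨_, hα, fun h' => absurd h h'⟩
    · have hne : (s₀.sicCov G S l m)⁻¹ *ᵥ (G.H l l *ᵥ t l m) ≠ 0 := fun h0 => h <| by
        rw [← (hpd l m).mulVec_nonsing_inv_mulVec (G.H l l *ᵥ t l m), h0, mulVec_zero]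
      obtain ⟨α, hα⟩ := exists_smul_norm_one hne
      exact ⟨_, hα, fun _ => ⟨α, rfl⟩⟩
  choose r hr1 hr2 using hr
  exact ⟨⟨M, p, t, r⟩, hp, ht, hdec, hr1, hr2⟩

end Streams

/-! ### Relay networks -/

namespace RelayNet

variable {L Q : ℕ} {nT nR : Fin L → ℕ} {N : ℕ → ℕ} {net : RelayNet L Q nT nR N}
  (S : ∀ l, Matrix (Fin (nT l)) (Fin (nT l)) ℂ) (Shat : ∀ l, Matrix (Fin (nR l)) (Fin (nR l)) ℂ)
  (F : ∀ q, Matrix (Fin (N q)) (Fin (N q)) ℂ) {d : ℕ → ℝ}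

theorem Standing.W'_posSemidef (hnet : net.Standing) (l : Fin L) : (net.W' F l).PosSemidef := by
  refine PosSemidef.add (posSemidef_sum _ fun q hq => ?_) (hnet.WD_psd l)
  have := (hnet.W_psd q hq).mul_mul_conjTranspose_same (net.HQ l * net.B F q Q)
  rwa [conjTranspose_mul, ← Matrix.mul_assoc] at this

/-- Zero weights are allowed because the lemma is applied to `d` minus its minimum. -/
theorem Standing.scaledWhat'_posSemidef (hnet : net.Standing)
    (hd : ∀ q ∈ Finset.Icc 1 (Q + 1), 0 ≤ d q) (l : Fin L) :
    (net.scaledWhat' d F l).PosSemidef := by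
  refine PosSemidef.add (posSemidef_sum _ fun q hq => ?_)
    ((hnet.WhatS_psd l).smul (by exact_mod_cast hd 1 (by simp)))
  have h := ((hnet.What_psd q hq).smul (show (0 : ℂ) ≤ (d (q + 1) : ℂ) by
    exact_mod_cast hd (q + 1) (by simp at hq ⊢; omega))).conjTranspose_mul_mul_same
      (net.B F 1 q * net.H0 l)
  rwa [conjTranspose_mul, ← Matrix.mul_assoc] at h

theorem scaledWhat'_eq_add (c : ℝ) (l : Fin L) :
    net.scaledWhat' d F l = net.scaledWhat' (fun q => d q - c) F l + (c : ℂ) • net.What' F l := by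
  simp only [scaledWhat', What', Complex.ofReal_sub, sub_smul, Matrix.mul_sub, Matrix.sub_mul,
    Finset.sum_sub_distrib, smul_add, Finset.smul_sum, Matrix.mul_smul, Matrix.smul_mul]
  abel

/-- With `c` the least weight, linearity in `d` splits off `c` times the unscaled matrix, which is
positive definite; the remaining weights `d q - c` are nonnegative. -/
theorem Standing.scaledWhat'_posDef (hnet : net.Standing)
    (hd : ∀ q ∈ Finset.Icc 1 (Q + 1), 0 < d q) {l : Fin L} (h : IsUnit (net.What' F l).det) :
    (net.scaledWhat' d F l).PosDef := by
  obtain ⟨q₀, hq₀, hmin⟩ := Finset.exists_min_image (Finset.Icc 1 (Q + 1)) d ⟨1, by simp⟩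
  rw [scaledWhat'_eq_add F (d q₀)]
  have hpsd : (net.What' F l).PosSemidef := by
    have := hnet.scaledWhat'_posSemidef F (d := fun _ => 1) (fun _ _ => zero_le_one) l
    simpa [scaledWhat', What'] using this
  refine PosDef.posSemidef_add
    (hnet.scaledWhat'_posSemidef F (fun q hq => sub_nonneg.mpr (hmin q hq)) l) ?_
  exact (hpsd.posDef_iff_det_ne_zero.mpr h.ne_zero).smul (by exact_mod_cast hd q₀ hq₀)

theorem Standing.scaledIFNet_regular (hnet : net.Standing)
    (hW' : ∀ l, IsUnit (net.W' F l).det) (hWhat' : ∀ l, IsUnit (net.What' F l).det)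
    (hd : ∀ q ∈ Finset.Icc 1 (Q + 1), 0 < d q) : (net.scaledIFNet d F).Regular where
  W_posDef l := (hnet.W'_posSemidef F l).posDef_iff_det_ne_zero.mpr (hW' l).ne_zero
  What_posDef l := hnet.scaledWhat'_posDef F hd (hWhat' l)
  Φ_nonneg l k := by
    rcases hnet.Φ_binary l k with h | h <;> simp [scaledIFNet, h]
  Φ_diag := hnet.Φ_diag

theorem Bhat_conjTranspose (q q' : ℕ) :
    net.Bhat (fun j => (F j)ᴴ) q q' = net.B F q q' := by
  simp only [Bhat, conjTranspose_conjTranspose]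

theorem dualH_conjTranspose (l k : Fin L) :
    net.dualH (fun j => (F j)ᴴ) l k = (net.Hcheck F k l)ᴴ := by
  simp only [dualH, Bhat_conjTranspose, Hcheck, conjTranspose_mul, Matrix.mul_assoc]

/-- Passing to the dual commutes with reduction to one hop, since adjoint precoders give adjoint
equivalent channels. -/
theorem dualΩ_conjTranspose (l : Fin L) :
    (net.scaleDualNoise d).dualΩ Shat (fun j => (F j)ᴴ) l =
      (net.scaledIFNet d F).dual.Ω Shat l := by
  simp only [dualΩ, dualH_conjTranspose, Bhat_conjTranspose, IFNet.Ω]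
  exact congrArg₂ (· + ·) (add_comm _ _) rfl

theorem dualRate_conjTranspose (l : Fin L) :
    (net.scaleDualNoise d).dualRate Shat (fun j => (F j)ᴴ) l =
      (net.scaledIFNet d F).dual.rate Shat l := by
  rw [dualRate, dualΩ_conjTranspose, dualH_conjTranspose]
  rfl

/-- Cyclicity of the trace collects all terms with `Shat` into `W'`. What is left is constraint
noise, injected at cluster `q'` of the dual and carried back to cluster `q ≤ q'`, paired with `W q`.
-/
theorem dualCost_conjTranspose :
    (net.scaleDualNoise d).dualCost Shat (fun j => (F j)ᴴ) =
      ∑ l, (Shat l * net.W' F l).trace.re + ∑ q ∈ Finset.Icc 1 Q, ∑ q' ∈ Finset.Icc q Q,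
        d (q' + 1) * (net.What q' * (net.B F q q' * net.W q * (net.B F q q')ᴴ)).trace.re := by
  have hB : ∀ q q', (net.scaleDualNoise d).Bhat (fun j => (F j)ᴴ) q q' = net.B F q q' :=
    fun q q' => Bhat_conjTranspose (net := net.scaleDualNoise d) F q q'
  simp only [dualCost, dualRelayCov, hB]
  have h1 : ∀ q l, ((net.B F q Q)ᴴ * (net.HQ l)ᴴ * Shat l * net.HQ l * net.B F q Q *
      net.W q).trace = (Shat l * (net.HQ l * net.B F q Q * net.W q * (net.B F q Q)ᴴ *
        (net.HQ l)ᴴ)).trace := fun q l => by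
    simp only [Matrix.mul_assoc]
    rw [trace_mul_comm, Matrix.mul_assoc, trace_mul_comm]
    simp only [Matrix.mul_assoc]
  have h2 : ∀ q q', ((net.B F q q')ᴴ * ((d (q' + 1) : ℂ) • net.What q') * net.B F q q' *
      net.W q).trace.re =
      d (q' + 1) * (net.What q' * (net.B F q q' * net.W q * (net.B F q q')ᴴ)).trace.re :=
    fun q q' => by
      rw [Matrix.mul_smul, Matrix.smul_mul, Matrix.smul_mul, trace_smul, smul_eq_mul,
        Complex.re_ofReal_mul, Matrix.mul_assoc, Matrix.mul_assoc, trace_mul_comm]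
      simp only [Matrix.mul_assoc]
  have hQ : ∀ l, (net.scaleDualNoise d).HQ l = net.HQ l := fun _ => rfl
  have hW : ∀ q, (net.scaleDualNoise d).W q = net.W q := fun _ => rfl
  have hWD : ∀ l, (net.scaleDualNoise d).WD l = net.WD l := fun _ => rfl
  have hWh : ∀ q, (net.scaleDualNoise d).What q = (d (q + 1) : ℂ) • net.What q := fun _ => rfl
  simp only [hQ, hW, hWD, hWh, W', Matrix.add_mul, Matrix.mul_add, Matrix.sum_mul, Matrix.mul_sum,
    trace_add, trace_sum, Complex.add_re, Complex.re_sum, Finset.sum_add_distrib, h1, h2]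
  rw [Finset.sum_comm (s := Finset.Icc 1 Q)]
  ring

/-- Here the terms with `S` collect into `scaledWhat'`; the rest is the noise of cluster `q'`
forwarded to cluster `q ≥ q'`. -/
theorem sum_mul_Ptx :
    ∑ q ∈ Finset.range (Q + 1), d (q + 1) * net.Ptx S F q =
      ∑ l, (S l * net.scaledWhat' d F l).trace.re + ∑ q ∈ Finset.Icc 1 Q, ∑ q' ∈ Finset.Icc 1 q,
        d (q + 1) * (net.What q * (net.B F q' q * net.W q' * (net.B F q' q)ᴴ)).trace.re := by
  have hrange : Finset.range (Q + 1) = insert 0 (Finset.Icc 1 Q) := by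
    ext q; simp; omega
  have h1 : ∀ q l, (net.B F 1 q * net.H0 l * S l * (net.H0 l)ᴴ * (net.B F 1 q)ᴴ *
      net.What q).trace.re =
      (S l * ((net.H0 l)ᴴ * (net.B F 1 q)ᴴ * net.What q * net.B F 1 q * net.H0 l)).trace.re :=
    fun q l => by
      simp only [Matrix.mul_assoc]
      rw [trace_mul_comm, Matrix.mul_assoc, trace_mul_comm]
      simp only [Matrix.mul_assoc]
  have h2 : ∀ q q', (net.B F q' q * net.W q' * (net.B F q' q)ᴴ * net.What q).trace =
      (net.What q * (net.B F q' q * net.W q' * (net.B F q' q)ᴴ)).trace :=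
    fun q q' => trace_mul_comm _ _
  have h3 : ∀ q ∈ Finset.Icc 1 Q, d (q + 1) * net.Ptx S F q =
      d (q + 1) * (net.relayCov S F q * net.What q).trace.re := fun q hq =>
    congrArg (d (q + 1) * ·) (if_neg (by simp at hq; omega))
  have h0 : net.Ptx S F 0 = ∑ l, (S l * net.WhatS l).trace.re := if_pos rfl
  rw [hrange, Finset.sum_insert (by simp), h0, Finset.sum_congr rfl h3]
  simp only [relayCov, scaledWhat', Matrix.mul_smul, Matrix.smul_mul, Matrix.add_mul,
    Matrix.sum_mul, trace_add, trace_sum, trace_smul, smul_eq_mul, Complex.add_re,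
    Complex.re_sum, Complex.re_ofReal_mul, Finset.sum_add_distrib, h1, h2, mul_add,
    Finset.mul_sum, zero_add]
  rw [Finset.sum_comm (s := Finset.Icc 1 Q) (t := Finset.univ)]
  ring

/-- The linear cost of the dual exceeds the one of the equivalent one-hop network by the same
amount as that of the forward network. -/
theorem dualCost_eq_sum_Ptx
    (h : ∑ l, (Shat l * net.W' F l).trace.re = ∑ l, (S l * net.scaledWhat' d F l).trace.re) :
    (net.scaleDualNoise d).dualCost Shat (fun j => (F j)ᴴ) =
      ∑ q ∈ Finset.range (Q + 1), d (q + 1) * net.Ptx S F q := by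
  rw [dualCost_conjTranspose, sum_mul_Ptx, h]
  congr 1
  -- Both double sums run over pairs of clusters in order of transmission; only the order of
  -- summation differs.
  refine Finset.sum_comm' fun q q' => ?_
  simp only [Finset.mem_Icc]
  omega

end RelayNet

theorem mainTheorem5 {L Q : ℕ} {nT nR : Fin L → ℕ} {N : ℕ → ℕ}
    (hQ : 1 ≤ Q) (hnR : ∀ l, 1 ≤ nR l)
    (net : RelayNet L Q nT nR N) (hnet : net.Standing)
    (S : ∀ l, Matrix (Fin (nT l)) (Fin (nT l)) ℂ) (hS : ∀ l, (S l).PosSemidef)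
    (F : ∀ q, Matrix (Fin (N q)) (Fin (N q)) ℂ)
    (hW' : ∀ l, IsUnit (net.W' F l).det) (hWhat' : ∀ l, IsUnit (net.What' F l).det)
    (d : ℕ → ℝ) (hd : ∀ q ∈ Finset.Icc 1 Q, 0 < d q) (hdQ : d (Q + 1) = 1) :
    (∃ s : Streams L nT nR, s.IsFor (net.scaledIFNet d F) S) ∧
    ∀ s : Streams L nT nR, s.IsFor (net.scaledIFNet d F) S →
      (∀ a, 0 < s.dEntry (net.scaledIFNet d F) a) ∧
      IsUnit ((s.D (net.scaledIFNet d F))⁻¹ - (s.Ψ (net.scaledIFNet d F))ᵀ).det ∧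
      (∀ a, 0 ≤ s.q (net.scaledIFNet d F) a) ∧
      (∀ l, (s.covTransform (net.scaledIFNet d F) l).PosSemidef) ∧
      (∀ l, net.rate S F l ≤
        (net.scaleDualNoise d).dualRate (s.covTransform (net.scaledIFNet d F))
          (fun q => (F q)ᴴ) l) ∧
      (net.scaleDualNoise d).dualCost (s.covTransform (net.scaledIFNet d F)) (fun q => (F q)ᴴ) =
        ∑ q ∈ Finset.range (Q + 1), d (q + 1) * net.Ptx S F q := by
  -- Cluster `Q` carries the weight `d (Q + 1)`, whose positivity comes from the normalization
  -- `hdQ`.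
  have hd' : ∀ q ∈ Finset.Icc 1 (Q + 1), 0 < d q := fun q hq => by
    rcases eq_or_ne q (Q + 1) with rfl | h
    · rw [hdQ]; exact one_pos
    · exact hd q (by simp at hq ⊢; omega)
  have hG := hnet.scaledIFNet_regular F hW' hWhat' hd'
  refine ⟨Streams.exists_isFor hG hnR hS, fun s hs => ⟨hs.dEntry_pos hG, hs.isUnit_det hG,
    hs.q_nonneg hG, hs.covTransform_posSemidef hG, fun l => ?_,
    RelayNet.dualCost_eq_sum_Ptx S _ F (hs.cost_eq hG)⟩⟩
  rw [RelayNet.dualRate_conjTranspose]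
  exact hs.rate_le_dual_rate hG l
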